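/- Theorem (CbN and CbV least-level normalization). Let $\Lambda$ be the set of pure $\lambda$-terms $t,s ::= x \mid \lambda x.t \mid ts$ over a countably infinite set of variables, taken up to renaming of bound variables; variables and abstractions are called values. Contexts, with exactly one hole, are $c ::= [\cdot] \mid \lambda x.c \mid c\,t \mid t\,c$, and $c[r]$ is the term obtained by replacing the hole of $c$ by $r$ (possibly capturing free variables of $r$). Let $\to_\beta$ and $\to_{\beta_v}$ be the closures under all contexts of the rules $(\lambda x.t)s \mapsto_\beta t\{s/x\}$ and $(\lambda x.t)v \mapsto_{\beta_v} t\{v/x\}$ ($v$ a value), respectively; a redex of a rule is a term that occurs as its left-hand side. The CbN level $\ell_n$ and the CbV level $\ell_v$ of a context are defined by $$\ell_n([\cdot])=0,\quad \ell_n(\lambda x.c)=\ell_n(c),\quad \ell_n(c\,t)=\ell_n(c),\quad \ell_n(t\,c)=\ell_n(c)+1;$$ $$\ell_v([\cdot])=0,\quad \ell_v(\lambda x.c)=\ell_v(c)+1,\quad \ell_v(c\,t)=\begin{cases}\ell_v(c') & \text{if } c=\lambda x.c'\\ \ell_v(c) & \text{otherwise,}\end{cases}\quad \ell_v(t\,c)=\ell_v(c).$$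 Given one of these levels $\ell$ and one of these rules $\rho$, the least level of a term $t$ is $\inf\{\ell(c) : t=c[r] \text{ for some } \rho\text{-redex } r\}\in\mathbb N\cup\{\infty\}$ (with $\inf\emptyset=\infty$), and a step $c[r]\to_\rho c[r']$, with $r\mapsto_\rho r'$, is a least-level step if $\ell(c)$ equals the least level of $c[r]$. Least-level $\beta$-reduction is defined with $\ell=\ell_n$ and $\rho=\beta$, least-level $\beta_v$-reduction with $\ell=\ell_v$ and $\rho=\beta_v$. A term is normal for a reduction if no step of the reduction starts from it. A reduction $\to_e\,\subseteq\,\to$ is a strategy for $\to$ if it has the same normal forms as $\to$; a strategy $\to_e$ for $\to$ is normalizing if, for every $t$ such that $t\to^* u$ for some $\to$-normal $u$, every maximal $\to_e$-sequence from $t$ is finite and ends in a $\to$-normal form. Then: 1. (CbN) least-level $\beta$-reduction is a normalizing strategy for $\to_\beta$ on $\Lambda$; 2. (CbV) least-level $\beta_v$-reduction is a normalizing strategy for $\to_{\beta_v}$ on $\Lambda$. -/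

import Mathlib

namespace LeastLevel

/-! ### Abstract rewriting: strategies and normalizing strategies -/

section Rewriting

variable {A : Type*}

/-- `u` is normal for the reduction `r`: there is no `r`-step from `u`. -/
def IsNormal (r : A → A → Prop) (u : A) : Prop := ∀ t, ¬ r u t

/-- `e` is a strategy for `r`: it is contained in `r` and has the same normal forms. -/
structure IsStrategy (e r : A → A → Prop) : Prop where
  subset : ∀ t s, e t s → r t s
  same_normal : ∀ t, IsNormal e t ↔ IsNormal r t

/-- `s 0, s 1, …` is a sequence from `t` made of `n` consecutive `r`-steps, where the length
`n` is a natural number or infinite. Only the entries `s i` with `i ≤ n` matter. -/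
def IsSequenceFrom (r : A → A → Prop) (t : A) (n : ℕ∞) (s : ℕ → A) : Prop :=
  s 0 = t ∧ ∀ i : ℕ, (i : ℕ∞) < n → r (s i) (s (i + 1))

/-- A maximal `r`-sequence from `t`: it cannot be prolonged, that is, it is infinite or its last
element is `r`-normal. -/
def IsMaximalSequenceFrom (r : A → A → Prop) (t : A) (n : ℕ∞) (s : ℕ → A) : Prop :=
  IsSequenceFrom r t n s ∧ ∀ m : ℕ, n = m → IsNormal r (s m)

/-- The reduction `e` is a normalizing strategy for `r`: it is a strategy for `r` and, whenever
`t` reduces by `r` to some `r`-normal form, every maximal `e`-sequence from `t` is finite and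
ends in an `r`-normal form. -/
structure IsNormalizingStrategy (e r : A → A → Prop) : Prop where
  strategy : IsStrategy e r
  normalizing : ∀ t u, Relation.ReflTransGen r t u → IsNormal r u →
    ∀ (n : ℕ∞) (s : ℕ → A), IsMaximalSequenceFrom e t n s →
      ∃ m : ℕ, n = m ∧ IsNormal r (s m)

end Rewriting

/-! ### Pure lambda-terms, up to renaming of bound variables -/

/-- Pure lambda-terms modulo alpha-equivalence, in de Bruijn notation: `var n` refers to the
`n`-th enclosing abstraction, or to a free variable if there are at most `n` of them. -/
inductive Term : Type
  | var : ℕ → Term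
  | lam : Term → Term
  | app : Term → Term → Term

namespace Term

/-- Extension of a renaming of variables under a binder. -/
def upRen (f : ℕ → ℕ) : ℕ → ℕ
  | 0 => 0
  | n + 1 => f n + 1

/-- Renaming of the free variables. -/
def rename (f : ℕ → ℕ) : Term → Term
  | var n => var (f n)
  | lam t => lam (rename (upRen f) t)
  | app t s => app (rename f t) (rename f s)

/-- Extension of a substitution under a binder. -/
def up (σ : ℕ → Term) : ℕ → Term
  | 0 => var 0
  | n + 1 => rename Nat.succ (σ n)

/-- Simultaneous capture-avoiding substitution. -/
def subst (σ : ℕ → Term) : Term → Term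
  | var n => σ n
  | lam t => lam (subst (up σ) t)
  | app t s => app (subst σ t) (subst σ s)

/-- The substitution that sends variable `0` to `s` and lowers every other variable by one. -/
def single (s : Term) : ℕ → Term
  | 0 => s
  | n + 1 => var n

/-- `t{s/x}`, where `x` is the variable bound by the abstraction whose body is `t`. -/
def inst (t s : Term) : Term := subst (single s) t

/-- Values: variables and abstractions. -/
inductive IsValue : Term → Prop
  | var (n : ℕ) : IsValue (var n)
  | lam (t : Term) : IsValue (lam t)

end Term

/-- The rule `(λx.t) s ↦ t{s/x}`. -/
inductive Beta : Term → Term → Prop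
  | mk (t s : Term) : Beta (.app (.lam t) s) (t.inst s)

/-- The rule `(λx.t) v ↦ t{v/x}` with `v` a value. -/
inductive BetaV : Term → Term → Prop
  | mk (t v : Term) (hv : v.IsValue) : BetaV (.app (.lam t) v) (t.inst v)

/-! ### Contexts, levels and least-level reduction -/

/-- Contexts with exactly one hole: `appL c t` is `c t`, and `appR t c` is `t c`. -/
inductive Ctx : Type
  | hole : Ctx
  | lam : Ctx → Ctx
  | appL : Ctx → Term → Ctx
  | appR : Term → Ctx → Ctx

namespace Ctx

/-- `c.fill t` replaces the hole of `c` by `t`, possibly capturing free variables of `t`. -/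
def fill : Ctx → Term → Term
  | hole, r => r
  | lam c, r => .lam (c.fill r)
  | appL c t, r => .app (c.fill r) t
  | appR t c, r => .app t (c.fill r)

/-- Call-by-name level of the hole: the number of arguments in which it is nested. -/
def levelN : Ctx → ℕ
  | hole => 0
  | lam c => c.levelN
  | appL c _ => c.levelN
  | appR _ c => c.levelN + 1

/-- Call-by-value level of the hole: the number of unapplied abstractions in which it is nested
(an abstraction is applied if it is the left-hand side of an application). -/
def levelV : Ctx → ℕ
  | hole => 0
  | lam c => c.levelV + 1
  | appL (lam c) _ => c.levelV
  | appL c _ => c.levelV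
  | appR _ c => c.levelV

end Ctx

/-- The reduction generated by a rule: its closure under contexts. -/
def Step (rule : Term → Term → Prop) (t s : Term) : Prop :=
  ∃ (c : Ctx) (r r' : Term), rule r r' ∧ t = c.fill r ∧ s = c.fill r'

/-- The redexes of a rule: the left-hand sides of its instances. -/
def redexes (rule : Term → Term → Prop) : Set Term := {r | ∃ r', rule r r'}

/-- The least level of a term: the infimum in `ℕ ∪ {∞}` of the levels of all its occurrences of
redexes, which is `∞` if there are none. -/
noncomputable def leastLevel (lev : Ctx → ℕ) (rule : Term → Term → Prop) (t : Term) : ℕ∞ :=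
  sInf {k : ℕ∞ | ∃ (c : Ctx) (r : Term), r ∈ redexes rule ∧ t = c.fill r ∧ k = (lev c : ℕ∞)}

/-- A reduction step at level `k`. -/
def StepAt (lev : Ctx → ℕ) (rule : Term → Term → Prop) (k : ℕ) (t s : Term) : Prop :=
  ∃ (c : Ctx) (r r' : Term), rule r r' ∧ t = c.fill r ∧ s = c.fill r' ∧ lev c = k

/-- Least-level reduction: a step whose level is the least level of the term. -/
def LeastLevelStep (lev : Ctx → ℕ) (rule : Term → Term → Prop) (t s : Term) : Prop :=
  ∃ k : ℕ, StepAt lev rule k t s ∧ (k : ℕ∞) = leastLevel lev rule t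

end LeastLevel

/-! Both conventions are treated at once through `Calling`: an unapplied abstraction costs
`lamLevel`, an argument position `argLevel`, and exactly one of the two is 1.

Uniqueness of lengths: contracting a redex copies or erases only redexes inside its argument, and
these have a strictly larger level, in CbN by their position, in CbV because the argument is a
value. Hence steps at a fixed level have the diamond property (`LevelStep.diamond`). Since no step
creates redexes of smaller level (`LevelStep.exists_of_lt`), least-level steps have it too
(`MinStep.diamond`). By random descent it then suffices to find one least-level reduction to the
normal form.

Existence: every reduction can be standardized (`Standard.tail`) into weak head steps followed by
standard reductions of the subterms. Weak head steps have level 0, hence least level. In an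
application, the reductions of the two sides are interleaved by always following an available
least-level step (`reflTransGen_minStep_app`). -/

namespace LeastLevel

/-! ### Random descent -/

section Rewriting

variable {A : Type*} {r : A → A → Prop}

/-- `Iter r n a b`: there are `n` consecutive `r`-steps from `a` to `b`. -/
inductive Iter (r : A → A → Prop) : ℕ → A → A → Prop
  | zero (a : A) : Iter r 0 a a
  | succ {n : ℕ} {a b c : A} : r a b → Iter r n b c → Iter r (n + 1) a c

/-- Two different one-step reducts of the same element have a common one-step reduct. -/
def Diamond (r : A → A → Prop) : Prop :=
  ∀ a b c, r a b → r a c → b = c ∨ ∃ d, r b d ∧ r c d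

theorem exists_iter_of_reflTransGen {a b : A} (h : Relation.ReflTransGen r a b) :
    ∃ n, Iter r n a b := by
  induction h using Relation.ReflTransGen.head_induction_on with
  | refl => exact ⟨0, .zero _⟩
  | head h _ ih => exact ih.imp' (· + 1) fun _ hn => .succ h hn

/-- Under the diamond property, every step from `a` gets closer to its normal form. -/
theorem Diamond.iter_of_step (hr : Diamond r) {n : ℕ} {a b u : A} (h : Iter r n a u)
    (hu : IsNormal r u) (hab : r a b) : ∃ m, n = m + 1 ∧ Iter r m b u := by
  induction h generalizing b with
  | zero a => exact absurd hab (hu _)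
  | @succ n a c u hac hcu ih =>
    refine ⟨n, rfl, ?_⟩
    rcases hr _ _ _ hac hab with rfl | ⟨d, hcd, hbd⟩
    · exact hcu
    · obtain ⟨m, rfl, hm⟩ := ih hu hcd
      exact .succ hbd hm

/-- Under the diamond property, a strategy that reaches a normal form whenever there is one is
normalizing. -/
theorem IsNormalizingStrategy.of_diamond {e : A → A → Prop} (hs : IsStrategy e r)
    (hd : Diamond e)
    (h : ∀ t u, Relation.ReflTransGen r t u → IsNormal r u → Relation.ReflTransGen e t u) :
    IsNormalizingStrategy e r := by
  refine ⟨hs, fun t u htu hu n s ⟨⟨h0, hseq⟩, hmax⟩ => ?_⟩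
  obtain ⟨N, hN⟩ := exists_iter_of_reflTransGen (h t u htu hu)
  have hue := (hs.same_normal u).2 hu
  -- Each step uses up exactly one of the `N` steps to `u`, so the sequence has at most `N` steps.
  have key : ∀ i : ℕ, (i : ℕ∞) ≤ n → ∃ m, N = m + i ∧ Iter e m (s i) u := by
    intro i
    induction i with
    | zero => exact fun _ => ⟨N, rfl, h0 ▸ hN⟩
    | succ i ih =>
      intro hi
      have hlt : (i : ℕ∞) < n := lt_of_lt_of_le (by exact_mod_cast Nat.lt_succ_self i) hi
      obtain ⟨m, rfl, hm⟩ := ih hlt.le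
      obtain ⟨m', rfl, hm'⟩ := hd.iter_of_step hm hue (hseq i hlt)
      exact ⟨m', by omega, hm'⟩
  have hn : n ≠ ⊤ := by
    rintro rfl
    obtain ⟨m, hm, -⟩ := key (N + 1) le_top
    omega
  lift n to ℕ using hn
  exact ⟨n, rfl, (hs.same_normal _).1 (hmax n rfl)⟩

end Rewriting

/-! ### Substitution -/

namespace Term

theorem subst_rename (σ : ℕ → Term) (f : ℕ → ℕ) (t : Term) :
    subst σ (rename f t) = subst (fun n => σ (f n)) t := by
  induction t generalizing σ f with
  | var n => rfl
  | lam t ih =>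
    simp only [rename, subst, ih]
    congr 2
    funext n
    cases n <;> rfl
  | app t s iht ihs => simp only [rename, subst, iht, ihs]

theorem rename_eq_subst (f : ℕ → ℕ) (t : Term) : rename f t = subst (fun n => var (f n)) t := by
  induction t generalizing f with
  | var n => rfl
  | lam t ih =>
    simp only [rename, subst, ih]
    congr 2
    funext n
    cases n <;> rfl
  | app t s iht ihs => simp only [rename, subst, iht, ihs]

theorem rename_rename (f g : ℕ → ℕ) (t : Term) :
    rename f (rename g t) = rename (fun n => f (g n)) t := by
  rw [rename_eq_subst f, subst_rename, rename_eq_subst]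

theorem rename_subst (f : ℕ → ℕ) (σ : ℕ → Term) (t : Term) :
    rename f (subst σ t) = subst (fun n => rename f (σ n)) t := by
  induction t generalizing σ f with
  | var n => rfl
  | lam t ih =>
    simp only [rename, subst, ih]
    congr 2
    funext n
    cases n with
    | zero => rfl
    | succ n => simp only [up, rename_rename, upRen]
  | app t s iht ihs => simp only [rename, subst, iht, ihs]

theorem subst_subst (τ σ : ℕ → Term) (t : Term) :
    subst τ (subst σ t) = subst (fun n => subst τ (σ n)) t := by
  induction t generalizing σ τ with
  | var n => rfl
  | lam t ih =>
    simp only [subst, ih]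
    congr 2
    funext n
    cases n with
    | zero => rfl
    | succ n => simp only [up, subst_rename, rename_subst]
  | app t s iht ihs => simp only [subst, iht, ihs]

theorem subst_var (t : Term) : subst var t = t := by
  have h : up var = var := by
    funext n
    cases n <;> rfl
  induction t with
  | var n => rfl
  | lam t ih => rw [subst, h, ih]
  | app t s iht ihs => rw [subst, iht, ihs]

theorem subst_inst (σ : ℕ → Term) (t s : Term) :
    subst σ (t.inst s) = (subst (up σ) t).inst (subst σ s) := by
  simp only [inst, subst_subst]
  congr 1
  funext n
  cases n with
  | zero => rfl
  | succ n =>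
    simp only [up, single, subst, subst_rename]
    exact (subst_var _).symm

end Term

open Term Relation

/-! ### Steps with a level, for both calling conventions -/

/-- The two calling conventions. -/
inductive Calling : Type
  | byName : Calling
  | byValue : Calling

namespace Calling

/-- The arguments that may be passed. -/
def Passable : Calling → Term → Prop
  | byName, _ => True
  | byValue, t => t.IsValue

/-- The contribution to the level of an unapplied abstraction. -/
def lamLevel : Calling → ℕ
  | byName => 0
  | byValue => 1

/-- The contribution to the level of an argument position. -/
def argLevel : Calling → ℕ
  | byName => 1
  | byValue => 0

/-- The level of a context. -/
def level : Calling → Ctx → ℕ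
  | byName => Ctx.levelN
  | byValue => Ctx.levelV

/-- The rewriting rule. -/
def rule : Calling → Term → Term → Prop
  | byName => Beta
  | byValue => BetaV

variable {m : Calling}

/-- `m.LevelStep k t s`: a step from `t` to `s` at level `k`, by recursion on the position. -/
inductive LevelStep (m : Calling) : ℕ → Term → Term → Prop
  | beta (t s : Term) (hs : m.Passable s) : LevelStep m 0 (.app (.lam t) s) (t.inst s)
  | lam {k : ℕ} {t t' : Term} : LevelStep m k t t' →
      LevelStep m (k + m.lamLevel) (.lam t) (.lam t')
  | appLam {k : ℕ} {t t' : Term} (s : Term) : LevelStep m k t t' →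
      LevelStep m k (.app (.lam t) s) (.app (.lam t') s)
  | appApp {k : ℕ} {t₁ t₂ t' : Term} (s : Term) : LevelStep m k (.app t₁ t₂) t' →
      LevelStep m k (.app (.app t₁ t₂) s) (.app t' s)
  | arg {k : ℕ} (t : Term) {s s' : Term} : LevelStep m k s s' →
      LevelStep m (k + m.argLevel) (.app t s) (.app t s')

theorem rule_iff {r r' : Term} :
    m.rule r r' ↔ ∃ t s, m.Passable s ∧ r = .app (.lam t) s ∧ r' = t.inst s := by
  cases m
  · exact ⟨fun ⟨t, s⟩ => ⟨t, s, trivial, rfl, rfl⟩, by rintro ⟨t, s, -, rfl, rfl⟩; exact .mk t s⟩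
  · exact ⟨fun ⟨t, s, hs⟩ => ⟨t, s, hs, rfl, rfl⟩,
      by rintro ⟨t, s, hs, rfl, rfl⟩; exact .mk t s hs⟩

theorem level_hole : m.level .hole = 0 := by cases m <;> rfl

theorem level_lam (c : Ctx) : m.level (.lam c) = m.level c + m.lamLevel := by cases m <;> rfl

theorem level_appL_lam (c : Ctx) (s : Term) : m.level (.appL (.lam c) s) = m.level c := by
  cases m <;> rfl

theorem level_appL {c : Ctx} (hc : ∀ c', c ≠ .lam c') (s : Term) :
    m.level (.appL c s) = m.level c := by
  cases m
  · rfl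
  · cases c with
    | lam c => exact absurd rfl (hc c)
    | _ => rfl

theorem level_appR (t : Term) (c : Ctx) : m.level (.appR t c) = m.level c + m.argLevel := by
  cases m <;> rfl

theorem levelStep_fill {r r' : Term} (h : m.rule r r') (c : Ctx) :
    m.LevelStep (m.level c) (c.fill r) (c.fill r') := by
  obtain ⟨t, s, hs, rfl, rfl⟩ := rule_iff.1 h
  induction c with
  | hole => rw [level_hole]; exact .beta t s hs
  | lam c ih => rw [level_lam]; exact .lam ih
  | appR u c ih => rw [level_appR]; exact .arg u ih
  | appL c u ih =>
    cases c with
    | lam c =>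
      rw [level_appL_lam]
      -- The induction hypothesis counts this abstraction as unapplied; inverting it recovers the
      -- step in the body, without that cost.
      rw [level_lam] at ih
      generalize hk : m.level c + m.lamLevel = k at ih
      cases ih with
      | @lam k' _ _ ih =>
        obtain rfl : m.level c = k' := by omega
        exact .appLam u ih
    | _ => rw [level_appL (by simp)]; exact .appApp u ih

theorem stepAt_iff {k : ℕ} {t s : Term} : StepAt m.level m.rule k t s ↔ m.LevelStep k t s := by
  constructor
  · rintro ⟨c, r, r', h, rfl, rfl, rfl⟩
    exact levelStep_fill h c
  · intro h
    induction h with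
    | beta t s hs => exact ⟨.hole, _, _, rule_iff.2 ⟨t, s, hs, rfl, rfl⟩, rfl, rfl, level_hole⟩
    | lam _ ih =>
      obtain ⟨c, r, r', h, rfl, rfl, rfl⟩ := ih
      exact ⟨.lam c, r, r', h, rfl, rfl, level_lam c⟩
    | appLam s _ ih =>
      obtain ⟨c, r, r', h, rfl, rfl, rfl⟩ := ih
      exact ⟨.appL (.lam c) s, r, r', h, rfl, rfl, level_appL_lam c s⟩
    | appApp s _ ih =>
      obtain ⟨c, r, r', h, ht, rfl, rfl⟩ := ih
      refine ⟨.appL c s, r, r', h, by rw [ht, Ctx.fill], rfl, level_appL ?_ s⟩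
      rintro c' rfl
      simp [Ctx.fill] at ht
    | arg t _ ih =>
      obtain ⟨c, r, r', h, rfl, rfl, rfl⟩ := ih
      exact ⟨.appR t c, r, r', h, rfl, rfl, level_appR t c⟩

theorem step_iff {t s : Term} : Step m.rule t s ↔ ∃ k, m.LevelStep k t s := by
  simp only [← stepAt_iff]
  exact ⟨fun ⟨c, r, r', h, ht, hs⟩ => ⟨_, c, r, r', h, ht, hs, rfl⟩,
    fun ⟨_, c, r, r', h, ht, hs, _⟩ => ⟨c, r, r', h, ht, hs⟩⟩

/-- A step at a level that is minimal among the steps from the same term. -/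
def MinStep (m : Calling) (t s : Term) : Prop :=
  ∃ k, m.LevelStep k t s ∧ ∀ i s', m.LevelStep i t s' → k ≤ i

theorem leastLevelStep_iff {t s : Term} :
    LeastLevelStep m.level m.rule t s ↔ m.MinStep t s := by
  refine exists_congr fun k => ?_
  rw [stepAt_iff]
  refine and_congr_right fun hk => ?_
  obtain ⟨c, r, r', hr, ht, -, hc⟩ := stepAt_iff.2 hk
  constructor
  · intro h i s' hi
    obtain ⟨c, r, r', hr, ht, -, rfl⟩ := stepAt_iff.2 hi
    have := h.trans_le (sInf_le ⟨c, r, ⟨r', hr⟩, ht, rfl⟩)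
    exact_mod_cast this
  · intro h
    refine le_antisymm (le_sInf ?_) (sInf_le ⟨c, r, ⟨r', hr⟩, ht, by rw [hc]⟩)
    rintro _ ⟨c, r, ⟨r', hr⟩, rfl, rfl⟩
    exact_mod_cast h _ _ (levelStep_fill hr c)

theorem exists_minStep {k : ℕ} {t s : Term} (h : m.LevelStep k t s) : ∃ s', m.MinStep t s' := by
  classical
  have hex : ∃ k s, m.LevelStep k t s := ⟨k, s, h⟩
  obtain ⟨s', hs'⟩ := Nat.find_spec hex
  exact ⟨s', _, hs', fun i u hi => Nat.find_min' hex ⟨u, hi⟩⟩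

/-! ### Passable terms -/

theorem Passable.var (n : ℕ) : m.Passable (.var n) := by
  cases m
  · trivial
  · exact .var n

theorem Passable.subst {σ : ℕ → Term} (hσ : ∀ n, m.Passable (σ n)) {t : Term}
    (ht : m.Passable t) : m.Passable (t.subst σ) := by
  cases m
  · trivial
  · cases ht with
    | var n => exact hσ n
    | lam t => exact .lam _

theorem Passable.up {σ : ℕ → Term} (hσ : ∀ n, m.Passable (σ n)) (n : ℕ) :
    m.Passable (up σ n) := by
  cases n with
  | zero => exact .var 0
  | succ n =>
    rw [Term.up, rename_eq_subst]
    exact .subst (fun _ => .var _) (hσ n)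

theorem Passable.single {s : Term} (hs : m.Passable s) (n : ℕ) : m.Passable (single s n) := by
  cases n with
  | zero => exact hs
  | succ n => exact .var n

/-! ### Creation and duplication of redexes, level by level -/

namespace LevelStep

variable {k : ℕ} {t s t' : Term}

theorem passable (h : m.LevelStep k t s) (ht : m.Passable t) : m.Passable s := by
  cases m
  · trivial
  · cases ht with
    | var n => cases h
    | lam t => cases h; exact .lam _

/-- In CbV a value contains redexes only under an unapplied abstraction. Consequently a root redex,
of level 0, never competes at its own level with a step in its argument. -/
theorem level_pos_of_passable (h : m.LevelStep k t s) (ht : m.Passable t) :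
    0 < k + m.argLevel := by
  cases m
  · exact Nat.succ_pos _
  · cases ht with
    | var n => cases h
    | lam t => cases h; exact Nat.succ_pos _

/-- Only a root contraction, of level 0, can turn a term that is not an abstraction into one. -/
theorem exists_lam_of_pos {s : Term} (h : m.LevelStep k t (.lam s)) (hk : 0 < k) :
    ∃ t', t = .lam t' := by
  generalize hs : Term.lam s = u at h
  cases h with
  | beta => omega
  | lam => exact ⟨_, rfl⟩
  | _ => cases hs

/-- In CbV, evaluating an argument to a value may create a redex, but only by a step of level 0. -/
theorem passable_of_passable (h : m.LevelStep k t s) (hk : 0 < k + m.argLevel)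
    (hs : m.Passable s) : m.Passable t := by
  cases m
  · trivial
  · cases h with
    | beta => exact absurd hk (lt_irrefl 0)
    | lam => exact .lam _
    | _ => cases hs

theorem lam_inv {k : ℕ} {t u : Term} (h : m.LevelStep k (.lam t) u) :
    ∃ i t', k = i + m.lamLevel ∧ u = .lam t' ∧ m.LevelStep i t t' := by
  cases h with
  | lam h => exact ⟨_, _, rfl, rfl, h⟩

theorem subst (h : m.LevelStep k t s) {σ : ℕ → Term} (hσ : ∀ n, m.Passable (σ n)) :
    m.LevelStep k (t.subst σ) (s.subst σ) := by
  induction h generalizing σ with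
  | beta t s hs => rw [subst_inst]; exact .beta _ _ (hs.subst hσ)
  | lam _ ih => exact .lam (ih (.up hσ))
  | appLam s _ ih => exact .appLam _ (ih (.up hσ))
  | appApp s _ ih => exact .appApp _ (ih hσ)
  | arg t _ ih => exact .arg _ (ih hσ)

/-- A step does not create redexes of a smaller level. -/
theorem exists_of_lt {i : ℕ} {s' : Term} (h : m.LevelStep k t s) (h' : m.LevelStep i s s')
    (hik : i < k) : ∃ t', m.LevelStep i t t' := by
  induction h generalizing i s' with
  | beta => omega
  | lam _ ih =>
    obtain ⟨i, _, rfl, rfl, hi⟩ := h'.lam_inv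
    obtain ⟨t', ht'⟩ := ih hi (by omega)
    exact ⟨_, .lam ht'⟩
  | appLam s _ ih =>
    cases h' with
    | beta _ _ hs => exact ⟨_, .beta _ _ hs⟩
    | appLam _ h' =>
      obtain ⟨t', ht'⟩ := ih h' hik
      exact ⟨_, .appLam _ ht'⟩
    | arg _ h' => exact ⟨_, .arg _ h'⟩
  | appApp s h ih =>
    cases h' with
    | beta _ _ hs => obtain ⟨_, h⟩ := h.exists_lam_of_pos hik; cases h
    | appLam _ h' => obtain ⟨_, h⟩ := h.exists_lam_of_pos (Nat.zero_lt_of_lt hik); cases h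
    | appApp _ h' =>
      obtain ⟨t', ht'⟩ := ih h' hik
      exact ⟨_, .appApp _ ht'⟩
    | arg _ h' => exact ⟨_, .arg _ h'⟩
  | arg t h ih =>
    cases h' with
    | beta _ _ hs => exact ⟨_, .beta _ _ (h.passable_of_passable hik hs)⟩
    | appLam _ h' => exact ⟨_, .appLam _ h'⟩
    | appApp _ h' => exact ⟨_, .appApp _ h'⟩
    | arg _ h' =>
      obtain ⟨t', ht'⟩ := ih h' (by omega)
      exact ⟨_, .arg _ ht'⟩

/-- If `t` is an abstraction, applying it could lower the level of the step inside it. But then `h`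
creates an abstraction, which forces `k = 0`, and nothing can drop. -/
theorem app_left_of_app {t₁ t₂ u : Term} (h : m.LevelStep k (.app t₁ t₂) t)
    (h' : m.LevelStep k t u) (s : Term) : m.LevelStep k (.app t s) (.app u s) := by
  cases t with
  | var n => cases h'
  | app => exact .appApp s h'
  | lam t =>
    obtain ⟨i, u, rfl, rfl, hi⟩ := h'.lam_inv
    rcases Nat.eq_zero_or_pos (i + m.lamLevel) with h0 | h0
    · rw [h0]
      obtain rfl : i = 0 := by omega
      exact .appLam s hi
    · obtain ⟨_, h⟩ := h.exists_lam_of_pos h0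
      cases h

/-- Steps at the same level never duplicate or erase each other. -/
theorem diamond (k : ℕ) : Diamond (m.LevelStep k) := by
  intro a b c hb hc
  induction hb generalizing c with
  | beta t s hs =>
    generalize hk : 0 = i at hc
    cases hc with
    | beta => exact .inl rfl
    | appLam _ h => subst hk; exact .inr ⟨_, h.subst hs.single, .beta _ _ hs⟩
    | arg _ h => have := h.level_pos_of_passable hs; omega
  | lam hb ih =>
    obtain ⟨i, _, hi, rfl, h⟩ := hc.lam_inv
    obtain rfl := Nat.add_right_cancel hi
    rcases ih _ h with rfl | ⟨d, hd, hd'⟩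
    · exact .inl rfl
    · exact .inr ⟨_, .lam hd, .lam hd'⟩
  | appLam s hb ih =>
    cases hc with
    | beta _ _ hs => exact .inr ⟨_, .beta _ _ hs, hb.subst hs.single⟩
    | appLam _ h =>
      rcases ih _ h with rfl | ⟨d, hd, hd'⟩
      · exact .inl rfl
      · exact .inr ⟨_, .appLam _ hd, .appLam _ hd'⟩
    | arg _ h => exact .inr ⟨_, .arg _ h, .appLam _ hb⟩
  | appApp s hb ih =>
    cases hc with
    | appApp _ h =>
      rcases ih _ h with rfl | ⟨d, hd, hd'⟩
      · exact .inl rfl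
      · exact .inr ⟨_, hb.app_left_of_app hd _, h.app_left_of_app hd' _⟩
    | arg _ h => exact .inr ⟨_, .arg _ h, .appApp _ hb⟩
  | @arg k t s s' hb ih =>
    generalize hk : k + m.argLevel = i at hc
    cases hc with
    | beta _ _ hs => have := hb.level_pos_of_passable hs; omega
    | appLam _ h => subst hk; exact .inr ⟨_, .appLam _ h, .arg _ hb⟩
    | appApp _ h => subst hk; exact .inr ⟨_, .appApp _ h, .arg _ hb⟩
    | arg _ h =>
      obtain rfl := Nat.add_right_cancel hk
      rcases ih _ h with rfl | ⟨d, hd, hd'⟩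
      · exact .inl rfl
      · exact .inr ⟨_, .arg _ hd, .arg _ hd'⟩

end LevelStep

/-! ### Steps of minimal level -/

namespace MinStep

theorem diamond : Diamond m.MinStep := by
  rintro a b c ⟨k, hb, hk⟩ ⟨i, hc, hi⟩
  obtain rfl := le_antisymm (hk _ _ hc) (hi _ _ hb)
  rcases LevelStep.diamond k a b c hb hc with h | ⟨d, hbd, hcd⟩
  · exact .inl h
  · have key : ∀ {x}, m.LevelStep k a x → ∀ i s', m.LevelStep i x s' → k ≤ i := by
      intro x hx i s' h
      by_contra! hik
      obtain ⟨t', ht'⟩ := hx.exists_of_lt h hik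
      exact absurd (hk _ _ ht') (not_le.2 hik)
    exact .inr ⟨d, ⟨k, hbd, key hb⟩, ⟨k, hcd, key hc⟩⟩

theorem lam {t s : Term} : m.MinStep t s → m.MinStep (.lam t) (.lam s) := by
  rintro ⟨k, h, hk⟩
  refine ⟨_, .lam h, fun i s' h' => ?_⟩
  obtain ⟨i, _, rfl, rfl, hi⟩ := h'.lam_inv
  exact Nat.add_le_add_right (hk _ _ hi) _

/-- A minimal step from an application is a root step or minimal in one of the two sides. -/
theorem app_inv {p q u : Term} (h : m.MinStep (.app p q) u) :
    ((∃ b, p = .lam b) ∧ m.Passable q) ∨ (∃ p', m.MinStep p p' ∧ u = .app p' q) ∨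
      ∃ q', m.MinStep q q' ∧ u = .app p q' := by
  obtain ⟨k, h, hk⟩ := h
  cases h with
  | beta b _ hq => exact .inl ⟨⟨b, rfl⟩, hq⟩
  | appLam _ h =>
    exact .inr (.inl ⟨_, lam ⟨k, h, fun i s' h' => hk i _ (.appLam _ h')⟩, rfl⟩)
  | appApp _ h => exact .inr (.inl ⟨_, ⟨k, h, fun i s' h' => hk i _ (.appApp _ h')⟩, rfl⟩)
  | arg _ h =>
    exact .inr (.inr ⟨_, ⟨_, h, fun i s' h' => Nat.le_of_add_le_add_right (hk _ _ (.arg _ h'))⟩,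
      rfl⟩)

theorem isLam_of_iter {n : ℕ} {b u : Term} (h : Iter m.MinStep n (.lam b) u) :
    ∃ b', u = .lam b' := by
  generalize ht : Term.lam b = t at h
  induction h generalizing b with
  | zero => exact ⟨b, ht.symm⟩
  | succ h _ ih =>
    subst ht
    obtain ⟨k, h, -⟩ := h
    obtain ⟨_, _, -, rfl, -⟩ := h.lam_inv
    exact ih rfl

theorem passable_of_iter {n : ℕ} {t u : Term} (h : Iter m.MinStep n t u) (ht : m.Passable t) :
    m.Passable u := by
  induction h with
  | zero => exact ht
  | succ h _ ih =>
    obtain ⟨k, h, -⟩ := h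
    exact ih (h.passable ht)

end MinStep

/-- `m.Normal u`: no step of any level starts from `u`. -/
def Normal (m : Calling) (u : Term) : Prop := ∀ k s, ¬ m.LevelStep k u s

theorem Normal.isNormal {u : Term} (hu : m.Normal u) : IsNormal m.MinStep u :=
  fun _ ⟨_, h, _⟩ => hu _ _ h

theorem Normal.of_lam {b : Term} (h : m.Normal (.lam b)) : m.Normal b :=
  fun _ _ hb => h _ _ (.lam hb)

theorem Normal.left {a c : Term} (h : m.Normal (.app a c)) : m.Normal a := by
  intro k s ha
  cases a with
  | var n => cases ha
  | app => exact h _ _ (.appApp _ ha)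
  | lam b =>
    obtain ⟨_, _, -, -, hb⟩ := ha.lam_inv
    exact h _ _ (.appLam _ hb)

theorem Normal.right {a c : Term} (h : m.Normal (.app a c)) : m.Normal c :=
  fun _ _ hc => h _ _ (.arg _ hc)

/-- Minimal steps normalize an application whose sides they normalize. -/
theorem reflTransGen_minStep_app {i j : ℕ} {p q a c : Term} (hp : Iter m.MinStep i p a)
    (hq : Iter m.MinStep j q c) (h : m.Normal (.app a c)) :
    ReflTransGen m.MinStep (.app p q) (.app a c) := by
  -- Whichever side the minimal step acts in, the diamond property makes that side's remaining
  -- length drop by one.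
  induction hn : i + j generalizing i j p q with
  | zero =>
    obtain ⟨rfl, rfl⟩ : i = 0 ∧ j = 0 := by omega
    cases hp
    cases hq
    exact .refl
  | succ n ih =>
    have hstep : ∃ u, m.MinStep (.app p q) u := by
      by_contra! hno
      have hpq : m.Normal (.app p q) := fun k s hs => by
        obtain ⟨u, hu⟩ := exists_minStep hs
        exact hno u hu
      cases hp with
      | succ hp => exact hpq.left.isNormal _ hp
      | zero =>
        cases hq with
        | succ hq => exact hpq.right.isNormal _ hq
        | zero => omega
    obtain ⟨u, hu⟩ := hstep
    rcases hu.app_inv with ⟨⟨b, rfl⟩, hpass⟩ | ⟨p', hp', rfl⟩ | ⟨q', hq', rfl⟩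
    -- Abstractions and passable terms are stable under reduction, so a root redex would survive in
    -- the normal form.
    · obtain ⟨b', rfl⟩ := MinStep.isLam_of_iter hp
      exact absurd (.beta _ _ (MinStep.passable_of_iter hq hpass)) (h _ _)
    · obtain ⟨i, rfl, hi⟩ := MinStep.diamond.iter_of_step hp h.left.isNormal hp'
      exact .head hu (ih hi hq (by omega))
    · obtain ⟨j, rfl, hj⟩ := MinStep.diamond.iter_of_step hq h.right.isNormal hq'
      exact .head hu (ih hp hj (by omega))

/-! ### Standardization -/

/-- Weak head reduction; arguments may be evaluated if they have level `0`. -/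
inductive HeadStep (m : Calling) : Term → Term → Prop
  | beta (t s : Term) (hs : m.Passable s) : HeadStep m (.app (.lam t) s) (t.inst s)
  | appL {t t' : Term} (s : Term) : HeadStep m t t' → HeadStep m (.app t s) (.app t' s)
  | appR (hm : m.argLevel = 0) (t : Term) {s s' : Term} : HeadStep m s s' →
      HeadStep m (.app t s) (.app t s')

theorem HeadStep.levelStep {t s : Term} (h : m.HeadStep t s) : m.LevelStep 0 t s := by
  induction h with
  | beta t s hs => exact .beta t s hs
  | @appL t _ s h ih =>
    cases t with
    | app => exact .appApp s ih
    | _ => cases h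
  | appR hm t _ ih => simpa only [hm] using LevelStep.arg t ih

theorem HeadStep.minStep {t s : Term} (h : m.HeadStep t s) : m.MinStep t s :=
  ⟨0, h.levelStep, fun _ _ _ => Nat.zero_le _⟩

theorem HeadStep.subst {t s : Term} (h : m.HeadStep t s) {σ : ℕ → Term}
    (hσ : ∀ n, m.Passable (σ n)) : m.HeadStep (t.subst σ) (s.subst σ) := by
  induction h with
  | beta t s hs => rw [subst_inst]; exact .beta _ _ (hs.subst hσ)
  | appL s _ ih => exact .appL _ ih
  | appR hm t _ ih => exact .appR hm _ ih

theorem HeadStep.rename {t s : Term} (h : m.HeadStep t s) (f : ℕ → ℕ) :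
    m.HeadStep (t.rename f) (s.rename f) := by
  simp only [rename_eq_subst]
  exact h.subst fun _ => .var _

/-- `m.Standard t u`: there is a standard reduction from `t` to `u`, which performs weak head
steps first and then proceeds inside the immediate subterms. -/
inductive Standard (m : Calling) : Term → Term → Prop
  | var {t : Term} {n : ℕ} : ReflTransGen m.HeadStep t (.var n) → Standard m t (.var n)
  | lam {t b b' : Term} : ReflTransGen m.HeadStep t (.lam b) → Standard m b b' →
      Standard m t (.lam b')
  | app {t a a' c c' : Term} : ReflTransGen m.HeadStep t (.app a c) → Standard m a a' →
      Standard m c c' → Standard m t (.app a' c')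

namespace Standard

variable {t s u : Term}

theorem refl (t : Term) : m.Standard t t := by
  induction t with
  | var n => exact .var .refl
  | lam t ih => exact .lam .refl ih
  | app t s iht ihs => exact .app .refl iht ihs

theorem head (h : ReflTransGen m.HeadStep t s) (hs : m.Standard s u) : m.Standard t u := by
  cases hs with
  | var h' => exact .var (h.trans h')
  | lam h' hb => exact .lam (h.trans h') hb
  | app h' ha hc => exact .app (h.trans h') ha hc

theorem rename (h : m.Standard t u) (f : ℕ → ℕ) : m.Standard (t.rename f) (u.rename f) := by
  induction h generalizing f with
  | var h => exact .var (h.lift _ fun _ _ h => h.rename f)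
  | lam h _ ih => exact .lam (h.lift _ fun _ _ h => h.rename f) (ih _)
  | app h _ _ iha ihc => exact .app (h.lift _ fun _ _ h => h.rename f) (iha f) (ihc f)

/-- At a variable, the substituted weak head steps are simply prefixed to the standard reduction
given by `hστ`. -/
theorem subst (h : m.Standard t u) {σ τ : ℕ → Term} (hσ : ∀ n, m.Passable (σ n))
    (hστ : ∀ n, m.Standard (σ n) (τ n)) : m.Standard (t.subst σ) (u.subst τ) := by
  induction h generalizing σ τ with
  | var h => exact head (h.lift _ fun _ _ h => h.subst hσ) (hστ _)
  | lam h _ ih =>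
    refine .lam (h.lift _ fun _ _ h => h.subst hσ) (ih (.up hσ) fun n => ?_)
    cases n with
    | zero => exact refl _
    | succ n => exact (hστ n).rename _
  | app h _ _ iha ihc =>
    exact .app (h.lift _ fun _ _ h => h.subst hσ) (iha hσ hστ) (ihc hσ hστ)

theorem inst {b b' v v' : Term} (hb : m.Standard b b') (hv : m.Passable v)
    (hvv : m.Standard v v') : m.Standard (b.inst v) (b'.inst v') := by
  refine hb.subst hv.single fun n => ?_
  cases n with
  | zero => exact hvv
  | succ n => exact refl _

/-- An argument that standardly reduces to a passable term can be made passable by head steps in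
argument position. -/
theorem exists_passable (h : m.Standard t u) (hu : m.Passable u) (p : Term) :
    ∃ v, m.Passable v ∧ m.Standard v u ∧ ReflTransGen m.HeadStep (.app p t) (.app p v) := by
  cases m
  · exact ⟨t, trivial, h, .refl⟩
  · cases h with
    | var h => exact ⟨_, .var _, refl _, h.lift _ fun _ _ h => .appR rfl p h⟩
    | lam h hb => exact ⟨_, .lam _, .lam .refl hb, h.lift _ fun _ _ h => .appR rfl p h⟩
    | app => cases hu

theorem lam_inv {b : Term} (h : m.Standard t (.lam b)) :
    ∃ a, ReflTransGen m.HeadStep t (.lam a) ∧ m.Standard a b := by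
  cases h with
  | lam h hb => exact ⟨_, h, hb⟩

theorem app_inv {a c : Term} (h : m.Standard t (.app a c)) :
    ∃ a₀ c₀, ReflTransGen m.HeadStep t (.app a₀ c₀) ∧ m.Standard a₀ a ∧ m.Standard c₀ c := by
  cases h with
  | app h ha hc => exact ⟨_, _, h, ha, hc⟩

/-- Only a root redex needs work: weak head steps expose the abstraction and, in CbV, evaluate the
argument to a value; the contraction then joins this weak head prefix. -/
theorem tail {k : ℕ} (h : m.Standard t u) (hus : m.LevelStep k u s) : m.Standard t s := by
  induction hus generalizing t with
  | beta b c hc =>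
    obtain ⟨a₀, c₀, h, ha, hc₀⟩ := h.app_inv
    obtain ⟨b₀, ha₀, hb⟩ := ha.lam_inv
    obtain ⟨v, hv, hvc, hcv⟩ := hc₀.exists_passable hc (.lam b₀)
    have h₁ : ReflTransGen m.HeadStep (.app a₀ c₀) (.app (.lam b₀) c₀) :=
      ha₀.lift (fun x => Term.app x c₀) fun _ _ h => .appL c₀ h
    exact head (((h.trans h₁).trans hcv).tail (.beta _ _ hv)) (hb.inst hv hvc)
  | lam _ ih =>
    obtain ⟨_, h, hb⟩ := h.lam_inv
    exact .lam h (ih hb)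
  | appLam s _ ih =>
    obtain ⟨_, _, h, ha, hc⟩ := h.app_inv
    obtain ⟨_, h', hb⟩ := ha.lam_inv
    exact .app h (.lam h' (ih hb)) hc
  | appApp s _ ih =>
    obtain ⟨_, _, h, ha, hc⟩ := h.app_inv
    exact .app h (ih ha) hc
  | arg t _ ih =>
    obtain ⟨_, _, h, ha, hc⟩ := h.app_inv
    exact .app h ha (ih hc)

/-- Normality of `u` is essential: its subterms are then normal too, so both sides of an application
are fully normalized and can be interleaved. -/
theorem reflTransGen_minStep (h : m.Standard t u) (hu : m.Normal u) :
    ReflTransGen m.MinStep t u := by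
  have key : ∀ {x y}, ReflTransGen m.HeadStep x y → ReflTransGen m.MinStep x y :=
    fun h => ReflTransGen.mono (fun _ _ h => h.minStep) _ _ h
  induction h with
  | var h => exact key h
  | lam h _ ih => exact (key h).trans ((ih hu.of_lam).lift _ fun _ _ h => h.lam)
  | app h _ _ iha ihc =>
    obtain ⟨i, hi⟩ := exists_iter_of_reflTransGen (iha hu.left)
    obtain ⟨j, hj⟩ := exists_iter_of_reflTransGen (ihc hu.right)
    exact (key h).trans (reflTransGen_minStep_app hi hj hu)

end Standard

theorem isNormalizingStrategy (m : Calling) :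
    IsNormalizingStrategy (LeastLevelStep m.level m.rule) (Step m.rule) := by
  have he : LeastLevelStep m.level m.rule = m.MinStep := by
    funext t s
    exact propext leastLevelStep_iff
  rw [he]
  refine .of_diamond ⟨fun t s ⟨k, h, _⟩ => step_iff.2 ⟨k, h⟩, fun t => ⟨fun h s hs => ?_, ?_⟩⟩
    MinStep.diamond fun t u htu hu => ?_
  · obtain ⟨k, hs⟩ := step_iff.1 hs
    obtain ⟨s', hs'⟩ := exists_minStep hs
    exact h s' hs'
  · exact fun h s ⟨k, hs, _⟩ => h s (step_iff.2 ⟨k, hs⟩)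
  · have hst : m.Standard t u := by
      clear hu
      induction htu with
      | refl => exact .refl t
      | tail _ h ih =>
        obtain ⟨k, h⟩ := step_iff.1 h
        exact ih.tail h
    exact hst.reflTransGen_minStep fun k s h => hu s (step_iff.2 ⟨k, h⟩)

end Calling

end LeastLevel

theorem mainTheorem3 :
    LeastLevel.IsNormalizingStrategy
      (LeastLevel.LeastLevelStep LeastLevel.Ctx.levelN LeastLevel.Beta)
      (LeastLevel.Step LeastLevel.Beta) ∧
    LeastLevel.IsNormalizingStrategy
      (LeastLevel.LeastLevelStep LeastLevel.Ctx.levelV LeastLevel.BetaV)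
      (LeastLevel.Step LeastLevel.BetaV) :=
  ⟨LeastLevel.Calling.isNormalizingStrategy .byName,
    LeastLevel.Calling.isNormalizingStrategy .byValue⟩
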